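/- Conventions. An arithmetic circuit over $\mathbb{C}$ in variables $\mathbf{x}=(x_1,\dots,x_n)$ is a finite directed acyclic graph with leaves labelled by variables or by constants from $\mathbb{C}$, with internal vertices of arbitrary fan-in labelled by $+$ or $\times$, and with one output vertex; its size is the number of its vertices plus the number of its wires. A $\Sigma\Pi\Sigma$ circuit over a field $\mathbb{F}$ is an expression $\sum_{i=1}^{m}\prod_{j=1}^{r_i}\ell_{ij}$, where each $\ell_{ij}$ is an affine form in $\mathbf{x}$ with coefficients in $\mathbb{F}$; its top fan-in is $m$ and its formal degree is $\max_i r_i$. Theorem. For every $k\in\mathbb{N}$ there is a constant $c\in\mathbb{N}$, depending only on $k$, such that the following holds for all natural numbers $n,d,s$ with $d\le s^k$. Let $P\in\mathbb{C}[\mathbf{x}]$ be a homogeneous polynomial of degree $d$ in $n$ variables that is computed by an arithmetic circuit of size at most $s$. Then for every integer $t$ with $1\le t\le d$ there is a $\Sigma\Pi\Sigma$ circuit $C_t$ over the field $\mathbb{C}(\varepsilon)$, of top fan-in at most $s^{ct}$ and of formal degree at most $s^{cd/t}$, such that $$C_t = P+\varepsilon Q$$ as polynomials in $\mathbf{x}$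 over $\mathbb{C}(\varepsilon)$, where $Q\in\mathbb{C}[\varepsilon,\mathbf{x}]$ and every monomial with a non-zero coefficient in $Q$ has degree in $\mathbf{x}$ strictly greater than $d$. -/

import Mathlib

open scoped Polynomial

namespace DepthThree

/-- The label of a vertex of an arithmetic circuit over `K` in the variables `x₀, …, xₙ₋₁`.
The vertex has `m` predecessors in a topological order of the circuit, and the in-neighbours of a
sum or product gate are taken among these. Fan-in is unbounded, and a repeated entry in the list of
in-neighbours is a parallel wire. -/
inductive Gate (K : Type*) (n m : ℕ) where
  | var (i : Fin n) : Gate K n m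
  | const (a : K) : Gate K n m
  | add (children : List (Fin m)) : Gate K n m
  | mul (children : List (Fin m)) : Gate K n m

/-- The number of wires that enter a vertex. -/
def Gate.fanIn {K : Type*} {n m : ℕ} : Gate K n m → ℕ
  | .var _ => 0
  | .const _ => 0
  | .add l => l.length
  | .mul l => l.length

/-- An arithmetic circuit: a finite directed acyclic graph, its vertices listed in a topological
order, with leaves labelled by variables and constants, internal vertices labelled by `+` or `×`,
and an output vertex. -/
structure ArithCircuit (K : Type*) (n : ℕ) where
  numVertices : ℕ
  gate : (v : Fin numVertices) → Gate K n v.val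
  output : Fin numVertices

namespace ArithCircuit

variable {K : Type*} {n : ℕ}

/-- The size of a circuit: the number of its vertices plus the number of its wires. -/
def size (Φ : ArithCircuit K n) : ℕ :=
  Φ.numVertices + ∑ v, (Φ.gate v).fanIn

/-- The polynomial computed at a vertex. -/
noncomputable def value [CommSemiring K] (Φ : ArithCircuit K n) (v : Fin Φ.numVertices) :
    MvPolynomial (Fin n) K :=
  match Φ.gate v with
  | .var i => MvPolynomial.X i
  | .const a => MvPolynomial.C a
  | .add l => (l.map fun u : Fin v.val => value Φ ⟨u.val, u.isLt.trans v.isLt⟩).sum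
  | .mul l => (l.map fun u : Fin v.val => value Φ ⟨u.val, u.isLt.trans v.isLt⟩).prod
termination_by v.val
decreasing_by all_goals exact u.isLt

/-- The polynomial computed by the circuit. -/
noncomputable def eval [CommSemiring K] (Φ : ArithCircuit K n) : MvPolynomial (Fin n) K :=
  Φ.value Φ.output

end ArithCircuit

/-- `P` is computable by an arithmetic circuit of size at most `s`. -/
def ComputableInSize {K : Type*} [CommSemiring K] {n : ℕ} (P : MvPolynomial (Fin n) K)
    (s : ℕ) : Prop :=
  ∃ Φ : ArithCircuit K n, Φ.eval = P ∧ Φ.size ≤ s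

/-- An affine form `a + b₀ x₀ + ⋯ + bₙ₋₁ xₙ₋₁` with coefficients in `K`. -/
structure AffineForm (K : Type*) (n : ℕ) where
  const : K
  coeff : Fin n → K

/-- An affine form as a polynomial. -/
noncomputable def AffineForm.toPoly {K : Type*} [CommSemiring K] {n : ℕ} (l : AffineForm K n) :
    MvPolynomial (Fin n) K :=
  MvPolynomial.C l.const + ∑ i, MvPolynomial.C (l.coeff i) * MvPolynomial.X i

/-- A `ΣΠΣ` circuit: a sum of products of affine forms, given by the list of its product gates,
each of them given by the list of its factors. -/
structure SigmaPiSigma (K : Type*) (n : ℕ) where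
  products : List (List (AffineForm K n))

namespace SigmaPiSigma

variable {K : Type*} {n : ℕ}

/-- The fan-in of the top sum gate. -/
def topFanIn (C : SigmaPiSigma K n) : ℕ := C.products.length

/-- The formal degree: the maximum of the degrees of the product gates, where the degree of a
product gate is the number of affine forms it multiplies (`0` if there are no product gates). -/
def formalDegree (C : SigmaPiSigma K n) : ℕ := (C.products.map List.length).foldr max 0

/-- The polynomial computed by the circuit. -/
noncomputable def eval [CommSemiring K] (C : SigmaPiSigma K n) : MvPolynomial (Fin n) K :=
  (C.products.map fun g => (g.map AffineForm.toPoly).prod).sum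

end SigmaPiSigma

end DepthThree

/-! Two facts carry the proof. The first is that, in the limit ε → 0, a homogeneous polynomial of
small degree needs only two product gates (`BorderApprox.of_isHomogeneous`). Write -f = ∑ Lᵢ^e with
linear forms Lᵢ. Then ∏ (1 - (εLᵢ)^e) = 1 + ε^e f + ε^(2e)(terms of degree at least 2e), and over ℂ
every factor 1 - (εLᵢ)^e splits into e affine forms. Subtracting 1 and dividing by ε^e leaves f with
an error that is divisible by ε and has only monomials of degree above e.

The second is a depth reduction by degree (`DegreeSystem.borderApprox`). The homogeneous components
of the gates satisfy an acyclic linear system: in a product the factor of larger degree is the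
unknown and the other one is its coefficient. Unrolling this system down to half the degree
(`DegreeSystem.eq_sum_cut`) writes each component as a sum of at most |G|² products of a path sum, a
coefficient and a component, all of at most half the degree. Path sums obey the same recursion.
Repeating until all degrees are at most D, about d/t, takes at most 4d/D ≤ 4t cuts along any
product. Each cut costs a factor polynomial in s in the top fan-in, so s^O(t) in all, while the
formal degree grows only by a factor O(t).

The pieces of degree at most D then get two product gates of formal degree s^O(D). Approximations
multiply without losing the degree condition on the error because the factors are homogeneous
(`BorderApprox.mul`). -/

namespace DepthThree

open MvPolynomial

/-! ### Sums and products of ΣΠΣ circuits -/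

namespace SigmaPiSigma

variable {K : Type*} {n : ℕ}

/-- Concatenation of the lists of product gates. -/
def add (C D : SigmaPiSigma K n) : SigmaPiSigma K n := ⟨C.products ++ D.products⟩

/-- The circuit whose product gates are the products of a gate of `C` and a gate of `D`. -/
def mul (C D : SigmaPiSigma K n) : SigmaPiSigma K n :=
  ⟨C.products.flatMap fun g => D.products.map fun h => g ++ h⟩

theorem eval_add [CommSemiring K] (C D : SigmaPiSigma K n) : (C.add D).eval = C.eval + D.eval := by
  simp [eval, add]

theorem eval_mul [CommSemiring K] (C D : SigmaPiSigma K n) : (C.mul D).eval = C.eval * D.eval := by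
  obtain ⟨L⟩ := C
  obtain ⟨M⟩ := D
  simp only [eval, mul]
  induction L with
  | nil => simp
  | cons g L ih =>
    have h : ((M.map fun h => g ++ h).map fun g => (g.map AffineForm.toPoly).prod).sum =
        (g.map AffineForm.toPoly).prod * (M.map fun g => (g.map AffineForm.toPoly).prod).sum := by
      simp [List.sum_map_mul_left, Function.comp_def]
    simp only [List.flatMap_cons, List.map_append, List.sum_append, List.map_cons, List.sum_cons,
      ih, h, add_mul]

theorem topFanIn_add (C D : SigmaPiSigma K n) :
    (C.add D).topFanIn = C.topFanIn + D.topFanIn := by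
  simp [topFanIn, add]

theorem topFanIn_mul (C D : SigmaPiSigma K n) :
    (C.mul D).topFanIn = C.topFanIn * D.topFanIn := by
  simp [topFanIn, mul, List.length_flatMap]

theorem formalDegree_le_iff (C : SigmaPiSigma K n) (M : ℕ) :
    C.formalDegree ≤ M ↔ ∀ g ∈ C.products, g.length ≤ M := by
  obtain ⟨L⟩ := C
  simp only [formalDegree]
  induction L with
  | nil => simp
  | cons g L ih => simp [ih]

end SigmaPiSigma

/-- A constant as an affine form. -/
def AffineForm.ofConst {K : Type*} [Zero K] (n : ℕ) (a : K) : AffineForm K n := ⟨a, 0⟩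

@[simp]
theorem AffineForm.toPoly_ofConst {K : Type*} [CommSemiring K] {n : ℕ} (a : K) :
    (AffineForm.ofConst n a).toPoly = C a := by
  simp [AffineForm.ofConst, AffineForm.toPoly]

variable {n : ℕ}

/-! ### Scalars ℂ, ℂ[ε], ℂ(ε) and the filtration by degree -/

/-- Extension of scalars from `ℂ` to `ℂ(ε)`. -/
noncomputable abbrev liftRat : MvPolynomial (Fin n) ℂ →+* MvPolynomial (Fin n) (RatFunc ℂ) :=
  map (algebraMap ℂ (RatFunc ℂ))

/-- Extension of scalars from `ℂ[ε]` to `ℂ(ε)`. -/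
noncomputable abbrev polyToRat :
    MvPolynomial (Fin n) ℂ[X] →+* MvPolynomial (Fin n) (RatFunc ℂ) :=
  map (algebraMap ℂ[X] (RatFunc ℂ))

theorem polyToRat_map_C (f : MvPolynomial (Fin n) ℂ) :
    polyToRat (map Polynomial.C f) = liftRat f := by
  rw [map_map]
  rfl

theorem polyToRat_C_X :
    polyToRat (C Polynomial.X : MvPolynomial (Fin n) ℂ[X]) = C RatFunc.X := by
  simp

theorem map_mem_pow_idealOfVars {R S : Type*} [CommRing R] [CommRing S] (φ : R →+* S)
    {f : MvPolynomial (Fin n) R} {e : ℕ} (hf : f.IsHomogeneous e) :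
    map φ f ∈ idealOfVars (Fin n) S ^ e := by
  rw [mem_pow_idealOfVars_iff]
  intro x hx
  have := (hf.map φ) (mem_support_iff.1 hx)
  rw [← this, Finsupp.degree_eq_weight_one]
  rfl

theorem _root_.MvPolynomial.IsHomogeneous.eq_sum_coeff_mul_X {R : Type*} [CommSemiring R]
    {f : MvPolynomial (Fin n) R} (hf : f.IsHomogeneous 1) :
    f = ∑ i, C (coeff (Finsupp.single i 1) f) * X i := by
  ext m
  rw [coeff_sum]
  simp only [coeff_C_mul, coeff_X, mul_ite, mul_one, mul_zero]
  by_cases hm : m.degree = 1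
  · obtain ⟨i, hi⟩ := Multiset.card_eq_one.1 ((Finsupp.card_toMultiset m).trans hm)
    obtain rfl : m = Finsupp.single i 1 := by
      classical
      rw [← Finsupp.toMultiset_toFinsupp m, hi, Multiset.toFinsupp_singleton]
    simp [Finsupp.single_left_inj]
  · rw [hf.coeff_eq_zero hm, eq_comm]
    refine Finset.sum_eq_zero fun i _ => if_neg ?_
    rintro rfl
    simp at hm

/-! ### Calculus of border approximations -/

/-- `f` is the value at `ε = 0` of a `ΣΠΣ` circuit over `ℂ(ε)` with top fan-in at most `N` and
formal degree at most `M`, where the error has all its monomials in degree greater than `e`. -/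
def BorderApprox (N M e : ℕ) (f : MvPolynomial (Fin n) ℂ) : Prop :=
  ∃ (Γ : SigmaPiSigma (RatFunc ℂ) n) (Q : MvPolynomial (Fin n) ℂ[X]),
    Γ.topFanIn ≤ N ∧ Γ.formalDegree ≤ M ∧
    Γ.eval = liftRat f + C RatFunc.X * polyToRat Q ∧ Q ∈ idealOfVars (Fin n) ℂ[X] ^ (e + 1)

namespace BorderApprox

variable {N N₁ N₂ M M₁ M₂ e e₁ e₂ : ℕ} {f f₁ f₂ : MvPolynomial (Fin n) ℂ}

theorem mono (h : BorderApprox N₁ M₁ e f) (hN : N₁ ≤ N) (hM : M₁ ≤ M) :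
    BorderApprox N M e f := by
  obtain ⟨Γ, Q, h1, h2, h3, h4⟩ := h
  exact ⟨Γ, Q, h1.trans hN, h2.trans hM, h3, h4⟩

theorem zero (N M e : ℕ) : BorderApprox N M e (0 : MvPolynomial (Fin n) ℂ) :=
  ⟨⟨[]⟩, 0, by simp [SigmaPiSigma.topFanIn], by simp [SigmaPiSigma.formalDegree],
    by simp [SigmaPiSigma.eval], Ideal.zero_mem _⟩

theorem const (a : ℂ) (e : ℕ) : BorderApprox 1 1 e (C a : MvPolynomial (Fin n) ℂ) :=
  ⟨⟨[[AffineForm.ofConst n (algebraMap ℂ (RatFunc ℂ) a)]]⟩, 0, by simp [SigmaPiSigma.topFanIn],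
    by simp [SigmaPiSigma.formalDegree], by simp [SigmaPiSigma.eval], Ideal.zero_mem _⟩

theorem of_isHomogeneous_one (hf : f.IsHomogeneous 1) : BorderApprox 1 1 e f := by
  refine ⟨⟨[[⟨0, fun i => algebraMap ℂ (RatFunc ℂ) (coeff (Finsupp.single i 1) f)⟩]]⟩, 0,
    by simp [SigmaPiSigma.topFanIn], by simp [SigmaPiSigma.formalDegree], ?_, Ideal.zero_mem _⟩
  conv_rhs => rw [hf.eq_sum_coeff_mul_X]
  simp [SigmaPiSigma.eval, AffineForm.toPoly]

theorem add (h₁ : BorderApprox N₁ M e f₁) (h₂ : BorderApprox N₂ M e f₂) :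
    BorderApprox (N₁ + N₂) M e (f₁ + f₂) := by
  obtain ⟨Γ, Q, h1, h2, h3, h4⟩ := h₁
  obtain ⟨Δ, R, k1, k2, k3, k4⟩ := h₂
  refine ⟨Γ.add Δ, Q + R, ?_, ?_, ?_, Ideal.add_mem _ h4 k4⟩
  · rw [SigmaPiSigma.topFanIn_add]; omega
  · rw [SigmaPiSigma.formalDegree_le_iff] at *
    simpa [SigmaPiSigma.add, or_imp, forall_and] using ⟨h2, k2⟩
  · rw [SigmaPiSigma.eval_add, h3, k3, map_add, map_add]; ring

theorem sum {ι : Type*} (s : Finset ι) (F : ι → MvPolynomial (Fin n) ℂ)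
    (h : ∀ i ∈ s, BorderApprox N M e (F i)) :
    BorderApprox (s.card * N) M e (∑ i ∈ s, F i) := by
  classical
  induction s using Finset.induction_on with
  | empty => simpa using zero _ _ _
  | insert a s ha ih =>
    rw [Finset.sum_insert ha, Finset.card_insert_of_notMem ha, add_mul, one_mul, add_comm _ N]
    exact (h a (Finset.mem_insert_self _ _)).add
      (ih fun i hi => h i (Finset.mem_insert_of_mem hi))

/-- Each error term pairs an error of degree above eᵢ with either the other main term, homogeneous
of degree exactly eⱼ, or the other error. Homogeneity is what keeps the total above e₁ + e₂. -/
theorem mul (h₁ : BorderApprox N₁ M₁ e₁ f₁) (h₂ : BorderApprox N₂ M₂ e₂ f₂)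
    (hf₁ : f₁.IsHomogeneous e₁) (hf₂ : f₂.IsHomogeneous e₂) :
    BorderApprox (N₁ * N₂) (M₁ + M₂) (e₁ + e₂) (f₁ * f₂) := by
  obtain ⟨Γ, Q, h1, h2, h3, h4⟩ := h₁
  obtain ⟨Δ, R, k1, k2, k3, k4⟩ := h₂
  refine ⟨Γ.mul Δ, map Polynomial.C f₁ * R + Q * map Polynomial.C f₂ +
    C Polynomial.X * (Q * R), ?_, ?_, ?_, ?_⟩
  · rw [SigmaPiSigma.topFanIn_mul]
    exact Nat.mul_le_mul h1 k1
  · rw [SigmaPiSigma.formalDegree_le_iff] at *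
    simp only [SigmaPiSigma.mul, List.mem_flatMap, List.mem_map]
    rintro _ ⟨g, hg, g', hg', rfl⟩
    have := h2 g hg
    have := k2 g' hg'
    rw [List.length_append]
    omega
  · rw [SigmaPiSigma.eval_mul, h3, k3]
    simp only [map_add, map_mul polyToRat, map_mul liftRat, polyToRat_map_C, polyToRat_C_X]
    ring
  · have a1 := Ideal.mul_mem_mul (map_mem_pow_idealOfVars Polynomial.C hf₁) k4
    have a2 := Ideal.mul_mem_mul h4 (map_mem_pow_idealOfVars Polynomial.C hf₂)
    have a3 := Ideal.mul_mem_mul h4 k4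
    rw [← pow_add] at a1 a2 a3
    refine Ideal.add_mem _ (Ideal.add_mem _ a1 (Ideal.pow_le_pow_right (by omega) a2))
      (Ideal.mul_mem_left _ _ (Ideal.pow_le_pow_right (by omega) a3))

end BorderApprox

/-! ### Homogeneous polynomials as sums of powers of linear forms -/

/-- Polarization: a product of `e` elements in terms of the `e`-th powers of its partial sums. -/
theorem factorial_mul_prod_eq_sum_pow {R : Type*} [CommRing R] {e : ℕ} (y : Fin e → R) :
    (e.factorial : R) * ∏ j, y j =
      ∑ S : Finset (Fin e), (-1) ^ (Sᶜ).card * (∑ j ∈ S, y j) ^ e := by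
  classical
  have h1 (S : Finset (Fin e)) : (∑ j ∈ S, y j) ^ e =
      ∑ φ : Fin e → Fin e, if Finset.univ.image φ ⊆ S then ∏ i, y (φ i) else 0 := by
    rw [Finset.sum_pow', ← Finset.sum_filter]
    refine Finset.sum_congr ?_ fun _ _ => rfl
    ext φ
    simp [Finset.subset_iff]
  -- The coefficient of a word φ is an alternating sum over the sets S containing its image. Through
  -- T = Sᶜ it runs over all subsets of the complement of the image, so it vanishes unless φ is
  -- surjective.
  have h2 (φ : Fin e → Fin e) : (∑ S : Finset (Fin e), (-1 : R) ^ (Sᶜ).card *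
      if Finset.univ.image φ ⊆ S then ∏ i, y (φ i) else 0) =
      if Function.Bijective φ then ∏ i, y i else 0 := by
    have h3 : (∑ S : Finset (Fin e), (-1 : R) ^ (Sᶜ).card *
        if Finset.univ.image φ ⊆ S then ∏ i, y (φ i) else 0) =
        (∑ T ∈ (Finset.univ.image φ)ᶜ.powerset, (-1 : R) ^ T.card) * ∏ i, y (φ i) := by
      rw [Finset.sum_mul]
      simp only [mul_ite, mul_zero]
      rw [← Finset.sum_filter]
      refine Finset.sum_nbij' (fun S => Sᶜ) (fun S => Sᶜ) ?_ ?_ ?_ ?_ ?_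
      · intro S hS
        simpa using hS
      · intro S hS
        rw [Finset.mem_powerset] at hS
        simpa using Finset.subset_compl_comm.1 hS
      · simp
      · simp
      · simp
    have h4 := congrArg (Int.cast : ℤ → R)
      (Finset.sum_powerset_neg_one_pow_card (x := (Finset.univ.image φ)ᶜ))
    push_cast at h4
    rw [h3, h4]
    by_cases hφ : Function.Bijective φ
    · have : (Finset.univ.image φ)ᶜ = ∅ := by
        rw [Finset.compl_eq_empty_iff, Finset.image_univ_of_surjective hφ.2]
      rw [if_pos this, if_pos hφ, one_mul]
      exact hφ.prod_comp y
    · have : ¬ (Finset.univ.image φ)ᶜ = ∅ := by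
        rw [Finset.compl_eq_empty_iff]
        intro h
        refine hφ (Finite.surjective_iff_bijective.1 fun b => ?_)
        have hb := Finset.mem_univ b
        rw [← h] at hb
        simpa using hb
      rw [if_neg this, if_neg hφ, zero_mul]
  simp only [h1, Finset.mul_sum]
  rw [Finset.sum_comm]
  simp only [h2]
  rw [← Finset.sum_filter, Finset.sum_const, nsmul_eq_mul]
  congr 2
  let E : {φ : Fin e → Fin e // Function.Bijective φ} ≃ Equiv.Perm (Fin e) :=
    ⟨fun φ => Equiv.ofBijective φ.1 φ.2, fun p => ⟨p, p.bijective⟩, fun _ => rfl,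
      fun _ => Equiv.ext fun _ => rfl⟩
  rw [← Fintype.card_subtype, Fintype.card_congr E, Fintype.card_perm, Fintype.card_fin]

theorem exists_prod_X_eq_monomial (m : Fin n →₀ ℕ) {e : ℕ} (hm : m.degree = e) :
    ∃ v : Fin e → Fin n,
      (monomial m 1 : MvPolynomial (Fin n) ℂ) = ∏ j, X (v j) := by
  have hc := (Finsupp.card_toMultiset m).trans hm
  obtain ⟨l, hl⟩ := Quot.exists_rep (Finsupp.toMultiset m)
  change (l : Multiset (Fin n)) = _ at hl
  rw [← hl, Multiset.coe_card] at hc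
  subst hc
  refine ⟨l.get, ?_⟩
  have h : (∏ j, X (l.get j) : MvPolynomial (Fin n) ℂ) = (l.map X).prod := by
    rw [← List.prod_ofFn, ← List.ofFn_get (l.map X)]
    simp
  rw [h, ← Multiset.prod_coe, ← Multiset.map_coe, hl, Finsupp.toMultiset_map,
    Finsupp.prod_toMultiset, Finsupp.prod_mapDomain_index (by simp) (by simp [pow_add]),
    monomial_eq, C_1, one_mul]

theorem multichoose_le_pow (a e : ℕ) : a.multichoose e ≤ a ^ e := by
  induction a generalizing e with
  | zero => cases e <;> simp
  | succ a iha =>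
    induction e with
    | zero => simp
    | succ e ihe =>
      rw [Nat.multichoose_succ_succ]
      calc _ ≤ a ^ (e + 1) + (a + 1) ^ e := add_le_add (iha _) ihe
        _ ≤ a * (a + 1) ^ e + (a + 1) ^ e := by
          rw [pow_succ, mul_comm]; gcongr; omega
        _ = _ := by ring

/-- A homogeneous polynomial of degree `e` is a sum of `e`-th powers of linear forms. -/
theorem exists_eq_sum_pow {σ : Finset (Fin n)} {e : ℕ} (he : 1 ≤ e) {f : MvPolynomial (Fin n) ℂ}
    (hf : f.IsHomogeneous e) (hσ : f ∈ supported ℂ (σ : Set (Fin n))) :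
    ∃ (s : Finset ((Fin n →₀ ℕ) × Finset (Fin e)))
      (L : (Fin n →₀ ℕ) × Finset (Fin e) → MvPolynomial (Fin n) ℂ),
      s.card ≤ (2 * σ.card) ^ e ∧ (∀ i, (L i).IsHomogeneous 1) ∧ f = ∑ i ∈ s, L i ^ e := by
  classical
  have key (m : Fin n →₀ ℕ) : ∃ L : Finset (Fin e) → MvPolynomial (Fin n) ℂ,
      (∀ S, (L S).IsHomogeneous 1) ∧ monomial m (coeff m f) = ∑ S, L S ^ e := by
    by_cases hm : m.degree = e
    · obtain ⟨v, hv⟩ := exists_prod_X_eq_monomial m hm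
      -- Over ℂ the scalar in front of each power has an e-th root, which is absorbed into the
      -- linear form.
      have hb (S : Finset (Fin e)) : ∃ b : ℂ,
          b ^ e = coeff m f * (e.factorial : ℂ)⁻¹ * (-1) ^ (Sᶜ).card :=
        IsAlgClosed.exists_pow_nat_eq _ he
      choose b hb using hb
      refine ⟨fun S => C (b S) * ∑ j ∈ S, X (v j), fun S => ?_, ?_⟩
      · simpa using (isHomogeneous_C (Fin n) (b S)).mul
          (IsHomogeneous.sum S _ 1 fun j _ => isHomogeneous_X ℂ (v j))
      · have hp := factorial_mul_prod_eq_sum_pow fun j => (X (v j) : MvPolynomial (Fin n) ℂ)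
        have h0 : (e.factorial : ℂ) ≠ 0 := by exact_mod_cast e.factorial_ne_zero
        calc monomial m (coeff m f)
            = C (coeff m f * (e.factorial : ℂ)⁻¹) * ((e.factorial : MvPolynomial (Fin n) ℂ) *
                ∏ j, X (v j)) := by
              rw [← hv, ← mul_assoc, ← map_natCast C e.factorial, ← C_mul, C_mul_monomial,
                mul_one, mul_assoc, inv_mul_cancel₀ h0, mul_one]
          _ = _ := by
              rw [hp, Finset.mul_sum]
              refine Finset.sum_congr rfl fun S _ => ?_
              rw [mul_pow, ← map_pow, hb, map_mul C _ ((-1) ^ _), map_pow, map_neg, map_one, mul_assoc]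
    · refine ⟨fun _ => 0, fun _ => isHomogeneous_zero _ _ _, ?_⟩
      rw [hf.coeff_eq_zero hm, Finset.sum_eq_zero fun _ _ => zero_pow (by omega), monomial_zero]
  choose L hL hL' using key
  refine ⟨σ.finsuppAntidiag e ×ˢ Finset.univ, fun i => L i.1 i.2, ?_, fun i => hL _ _, ?_⟩
  · rw [Finset.card_product, Finset.card_finsuppAntidiag_nat_eq_multichoose, Finset.card_univ,
      Fintype.card_finset, Fintype.card_fin, mul_pow, mul_comm]
    exact Nat.mul_le_mul_left _ (multichoose_le_pow _ _)
  · rw [Finset.sum_product]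
    simp only [← hL']
    conv_lhs => rw [f.as_sum]
    refine Finset.sum_subset (fun m hm => ?_) fun m _ hm => by simp [notMem_support_iff.1 hm]
    rw [Finset.mem_finsuppAntidiag']
    constructor
    · have := hf (mem_support_iff.1 hm)
      rwa [Pi.one_def, ← Finsupp.degree_eq_weight_one] at this
    · intro i hi
      exact (mem_supported.1 hσ) ((mem_vars_iff_mem_support i).2 ⟨m, hm, hi⟩)

/-! ### Two product gates suffice in the limit -/

/-- Factorization of `1 - y ^ e` into linear factors over `ℂ`. -/
theorem one_sub_pow_eq_prod {A : Type*} [CommRing A] [IsDomain A] (φ : ℂ →+* A) {e : ℕ}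
    (he : 0 < e) (y : A) :
    1 - y ^ e = ∏ ζ ∈ Polynomial.nthRootsFinset e (1 : ℂ), (1 - φ ζ * y) := by
  have hφ := φ.injective
  have h : IsPrimitiveRoot _ e := Complex.isPrimitiveRoot_exp e he.ne'
  have h' := h.map_of_injective hφ
  have := h'.pow_sub_pow_eq_prod_sub_mul 1 y he
  rw [one_pow] at this
  rw [this]
  refine (Finset.prod_nbij φ (fun a ha => Polynomial.map_mem_nthRootsFinset_one ha _)
    (fun a _ b _ H => hφ H) (fun a ha => ?_) (fun _ _ => rfl)).symm
  -- Both sets of e-th roots of unity have e elements, so the injection between them is onto.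
  have := Set.surj_on_of_inj_on_of_ncard_le (s := Polynomial.nthRootsFinset e (1 : ℂ))
    (t := Polynomial.nthRootsFinset e (1 : A)) (fun a _ => φ a)
    (fun _ hr => Polynomial.map_mem_nthRootsFinset_one hr _)
    (fun a _ b _ H => hφ H)
    (by simp [h.card_nthRootsFinset, h'.card_nthRootsFinset])
  obtain ⟨x, hx, hx1⟩ := this _ ha
  exact ⟨x, hx, hx1.symm⟩

/-- Expansion of `∏ (1 - a gᵢ)` to first order. -/
theorem exists_prod_one_sub_eq {A ι : Type*} [CommRing A] (I J : Ideal A) (hJ : I * I ≤ J)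
    (a : A) (s : Finset ι) (g : ι → A) (hg : ∀ i ∈ s, g i ∈ I) :
    ∃ Q ∈ J, ∏ i ∈ s, (1 - a * g i) = 1 - a * ∑ i ∈ s, g i + a * a * Q := by
  classical
  induction s using Finset.induction_on with
  | empty => exact ⟨0, J.zero_mem, by simp⟩
  | insert i s hi ih =>
    obtain ⟨Q, hQ, h⟩ := ih fun j hj => hg j (Finset.mem_insert_of_mem hj)
    have hs : ∑ j ∈ s, g j ∈ I := Ideal.sum_mem _ fun j hj => hg j (Finset.mem_insert_of_mem hj)
    refine ⟨Q + g i * ∑ j ∈ s, g j - a * g i * Q, ?_, ?_⟩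
    · exact J.sub_mem (J.add_mem hQ (hJ (Ideal.mul_mem_mul (hg i (Finset.mem_insert_self _ _)) hs)))
        (J.mul_mem_left _ hQ)
    · rw [Finset.prod_insert hi, Finset.sum_insert hi, h]
      ring

/-- One gate is ε⁻ᵉ ∏ (1 - ζεLᵢ), over all i and all e-th roots of unity ζ; the other is the
constant -ε⁻ᵉ. The error begins in degree 2e, which exceeds e only for e ≥ 1, so constants are
treated apart. -/
theorem BorderApprox.of_isHomogeneous {σ : Finset (Fin n)} {e : ℕ} {f : MvPolynomial (Fin n) ℂ}
    (hf : f.IsHomogeneous e) (hσ : f ∈ supported ℂ (σ : Set (Fin n))) :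
    BorderApprox 2 (1 + (2 * σ.card) ^ e * e) e f := by
  classical
  rcases Nat.eq_zero_or_pos e with rfl | he
  · obtain ⟨a, rfl⟩ : ∃ a, f = C a :=
      ⟨_, totalDegree_eq_zero_iff_eq_C.1 (Nat.le_zero.1 hf.totalDegree_le)⟩
    exact (const a 0).mono (by omega) (by omega)
  -- Decomposing -f makes the first-order term of the product equal to +ε^e f.
  obtain ⟨s, L, hs, hL, hfL⟩ := exists_eq_sum_pow he hf.neg (neg_mem hσ)
  set Z := Polynomial.nthRootsFinset e (1 : ℂ)
  have hZ : Z.card = e := (Complex.isPrimitiveRoot_exp e he.ne').card_nthRootsFinset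
  let ι := algebraMap ℂ (RatFunc ℂ)
  have hε : (RatFunc.X : RatFunc ℂ) ≠ 0 := RatFunc.X_ne_zero
  let form (p : ((Fin n →₀ ℕ) × Finset (Fin e)) × ℂ) : AffineForm (RatFunc ℂ) n :=
    ⟨1, fun i => -(ι p.2 * RatFunc.X * ι (coeff (Finsupp.single i 1) (L p.1)))⟩
  have hform (p) : (form p).toPoly = 1 - C (ι p.2) * (C RatFunc.X * liftRat (L p.1)) := by
    conv_rhs => rw [(hL p.1).eq_sum_coeff_mul_X]
    simp only [form, AffineForm.toPoly, map_sum, map_mul, map_X, map_C, C_1, Finset.mul_sum,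
      map_neg, sub_eq_add_neg, ← Finset.sum_neg_distrib]
    congr 1
    refine Finset.sum_congr rfl fun i _ => ?_
    ring
  obtain ⟨Q, hQ, hprod⟩ := exists_prod_one_sub_eq (idealOfVars (Fin n) ℂ[X] ^ e)
    (idealOfVars (Fin n) ℂ[X] ^ (e + e)) (by rw [pow_add]) (C Polynomial.X ^ e) s
    (fun i => map Polynomial.C (L i ^ e)) (fun i _ => map_mem_pow_idealOfVars _ (by
      simpa using (hL i).pow e))
  have hprod' : ∏ i ∈ s, (1 - (C RatFunc.X * liftRat (L i)) ^ e) =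
      1 + C RatFunc.X ^ e * liftRat f + C RatFunc.X ^ e * C RatFunc.X ^ e * polyToRat Q := by
    have := congrArg polyToRat hprod
    rw [← map_sum, ← hfL] at this
    simp only [map_add, map_sub, map_one, map_mul polyToRat, map_prod, map_pow, polyToRat_C_X,
      polyToRat_map_C, map_neg] at this
    simp only [mul_pow, this]
    ring
  -- Division by ε^e turns the second-order term into ε^e Q; one ε is the explicit factor in
  -- `BorderApprox`, which leaves ε^(e-1) Q.
  refine ⟨⟨[AffineForm.ofConst n (RatFunc.X ^ e)⁻¹ :: (s ×ˢ Z).toList.map form,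
    [AffineForm.ofConst n (-(RatFunc.X ^ e)⁻¹)]]⟩, C Polynomial.X ^ (e - 1) * Q, ?_, ?_, ?_, ?_⟩
  · simp [SigmaPiSigma.topFanIn]
  · have : s.card * e ≤ (2 * σ.card) ^ e * e := Nat.mul_le_mul_right _ hs
    simp [SigmaPiSigma.formalDegree, hZ]
    omega
  · have h1 : (((s ×ˢ Z).toList.map form).map AffineForm.toPoly).prod =
        ∏ i ∈ s, (1 - (C RatFunc.X * liftRat (L i)) ^ e) := by
      rw [List.map_map, Finset.prod_map_toList, Finset.prod_product]
      refine Finset.prod_congr rfl fun i _ => ?_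
      rw [one_sub_pow_eq_prod (C.comp ι) he]
      refine Finset.prod_congr rfl fun ζ _ => ?_
      rw [Function.comp_apply, hform]
      rfl
    have h2 : (C (RatFunc.X ^ e)⁻¹ : MvPolynomial (Fin n) (RatFunc ℂ)) * C RatFunc.X ^ e = 1 := by
      rw [← C_pow, ← C_mul, inv_mul_cancel₀ (pow_ne_zero _ hε), C_1]
    have h3 : (C RatFunc.X : MvPolynomial (Fin n) (RatFunc ℂ)) ^ e =
        C RatFunc.X * C RatFunc.X ^ (e - 1) := by
      rw [← pow_succ', Nat.sub_add_cancel he]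
    simp only [SigmaPiSigma.eval, List.map_cons, List.map_nil, List.prod_cons, List.prod_nil,
      List.sum_cons, List.sum_nil, AffineForm.toPoly_ofConst, h1, hprod', map_mul polyToRat,
      map_pow, polyToRat_C_X, map_neg]
    linear_combination (liftRat f + C RatFunc.X ^ e * polyToRat Q) * h2 + polyToRat Q * h3
  · exact Ideal.mul_mem_left _ _ (Ideal.pow_le_pow_right (by omega) hQ)

/-! ### Degree systems, path sums and cuts -/

/-- Homogeneous polynomials that satisfy an acyclic linear system whose coefficients are, up to
constants, polynomials of the same system, and in which no edge lowers the degree by more than a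
factor of two. -/
structure DegreeSystem (n : ℕ) (G : Type) [Fintype G] where
  deg : G → ℕ
  rank : G → ℕ
  poly : G → MvPolynomial (Fin n) ℂ
  coef : G → G → MvPolynomial (Fin n) ℂ
  isHomogeneous : ∀ g, (poly g).IsHomogeneous (deg g)
  poly_eq : ∀ g, 2 ≤ deg g → poly g = ∑ h, coef g h * poly h
  rank_lt : ∀ g h, coef g h ≠ 0 → rank h < rank g
  deg_le_two_mul : ∀ g h, coef g h ≠ 0 → deg g ≤ 2 * deg h
  coef_eq : ∀ g h, coef g h ≠ 0 → ∃ c,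
    (deg h = deg g ∧ coef g h = C c) ∨ ∃ x, deg x + deg h = deg g ∧ coef g h = C c * poly x

namespace DegreeSystem

variable {n : ℕ} {G : Type} [Fintype G] (Φ : DegreeSystem n G)

theorem deg_le {g h : G} (H : Φ.coef g h ≠ 0) : Φ.deg h ≤ Φ.deg g := by
  obtain ⟨c, ⟨h1, -⟩ | ⟨x, h1, -⟩⟩ := Φ.coef_eq g h H <;> omega

theorem coef_isHomogeneous (g h : G) : (Φ.coef g h).IsHomogeneous (Φ.deg g - Φ.deg h) := by
  by_cases H : Φ.coef g h = 0
  · rw [H]; exact isHomogeneous_zero _ _ _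
  obtain ⟨c, ⟨h1, h2⟩ | ⟨x, h1, h2⟩⟩ := Φ.coef_eq g h H
  · rw [h2, h1, Nat.sub_self]; exact isHomogeneous_C _ _
  · rw [h2, ← h1, Nat.add_sub_cancel]; exact (Φ.isHomogeneous x).C_mul c

open Classical in
/-- The sum over all paths from `u` to `v` of the products of the coefficients on the path. -/
noncomputable def quot (u v : G) : MvPolynomial (Fin n) ℂ :=
  (if u = v then 1 else 0) +
    ∑ h, if _ : Φ.rank h < Φ.rank u then Φ.coef u h * quot h v else 0
termination_by Φ.rank u

-- The rank guard in `quot` only secures termination: an edge that does not lower the rank has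
-- coefficient zero.
open Classical in
theorem quot_eq (u v : G) :
    Φ.quot u v = (if u = v then 1 else 0) + ∑ h, Φ.coef u h * Φ.quot h v := by
  rw [quot]
  congr 1
  refine Finset.sum_congr rfl fun h _ => ?_
  split_ifs with H
  · rfl
  · rw [not_imp_comm.1 (Φ.rank_lt u h) H, zero_mul]

theorem rank_induction {p : G → Prop}
    (h : ∀ u, (∀ w, Φ.coef u w ≠ 0 → p w) → p u) (u : G) : p u := by
  induction hr : Φ.rank u using Nat.strong_induction_on generalizing u with
  | _ r ih => exact h u fun w hw => ih _ (hr ▸ Φ.rank_lt u w hw) w rfl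

/-- The degree never rises along an edge, so no path leads to a vertex of larger degree. -/
theorem quot_eq_zero {u v : G} (h : Φ.deg u < Φ.deg v) : Φ.quot u v = 0 := by
  induction u using Φ.rank_induction with
  | h u ih =>
    rw [quot_eq, if_neg (by rintro rfl; omega), zero_add]
    refine Finset.sum_eq_zero fun w _ => ?_
    by_cases H : Φ.coef u w = 0
    · rw [H, zero_mul]
    · rw [ih w H ((Φ.deg_le H).trans_lt h), mul_zero]

theorem quot_isHomogeneous (u v : G) : (Φ.quot u v).IsHomogeneous (Φ.deg u - Φ.deg v) := by
  induction u using Φ.rank_induction with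
  | h u ih =>
    rw [quot_eq]
    refine IsHomogeneous.add ?_ (IsHomogeneous.sum _ _ _ fun w _ => ?_)
    · split_ifs with H
      · rw [H, Nat.sub_self]; exact isHomogeneous_one _ _
      · exact isHomogeneous_zero _ _ _
    · by_cases H : Φ.coef u w = 0
      · rw [H, zero_mul]; exact isHomogeneous_zero _ _ _
      by_cases H' : Φ.deg w < Φ.deg v
      · rw [Φ.quot_eq_zero H', mul_zero]; exact isHomogeneous_zero _ _ _
      have := Φ.deg_le H
      convert (Φ.coef_isHomogeneous u w).mul (ih w H) using 1
      omega

/-- Cutting all paths where the degree drops to `m` or below. -/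
theorem eq_sum_cut (V : G → MvPolynomial (Fin n) ℂ) (m : ℕ)
    (hV : ∀ u, m < Φ.deg u → V u = ∑ h, Φ.coef u h * V h) (u : G) (hu : m < Φ.deg u) :
    V u = ∑ p : G × G with m < Φ.deg p.1 ∧ Φ.deg p.2 ≤ m,
      Φ.quot u p.1 * Φ.coef p.1 p.2 * V p.2 := by
  classical
  have hprod : (Finset.univ.filter fun p : G × G => m < Φ.deg p.1 ∧ Φ.deg p.2 ≤ m) =
      (Finset.univ.filter fun g => m < Φ.deg g) ×ˢ (Finset.univ.filter fun g => Φ.deg g ≤ m) := by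
    ext p; simp
  rw [hprod]
  clear hprod
  induction u using Φ.rank_induction with
  | h u ih =>
    set U := Finset.univ.filter fun g => m < Φ.deg g
    set W := Finset.univ.filter fun g => Φ.deg g ≤ m
    have h1 : ∑ p ∈ U ×ˢ W, Φ.quot u p.1 * Φ.coef p.1 p.2 * V p.2 =
        ∑ h ∈ W, Φ.coef u h * V h +
          ∑ h, Φ.coef u h * ∑ p ∈ U ×ˢ W, Φ.quot h p.1 * Φ.coef p.1 p.2 * V p.2 := by
      have h2 (p : G × G) : Φ.quot u p.1 * Φ.coef p.1 p.2 * V p.2 =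
          (if u = p.1 then Φ.coef p.1 p.2 * V p.2 else 0) +
            ∑ h, Φ.coef u h * (Φ.quot h p.1 * Φ.coef p.1 p.2 * V p.2) := by
        rw [quot_eq, add_mul, add_mul, Finset.sum_mul, Finset.sum_mul]
        congr 1
        · split_ifs <;> simp
        · exact Finset.sum_congr rfl fun h _ => by ring
      simp only [h2, Finset.sum_add_distrib]
      congr 1
      · rw [Finset.sum_product]
        simp only [Finset.sum_ite_irrel, Finset.sum_const_zero, Finset.sum_ite_eq]
        rw [if_pos (by simpa [U] using hu)]
      · rw [Finset.sum_comm]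
        simp only [Finset.mul_sum]
    rw [h1, hV u hu, Finset.sum_filter, ← Finset.sum_add_distrib]
    refine Finset.sum_congr rfl fun h _ => ?_
    by_cases H : Φ.coef u h = 0
    · simp [H]
    -- An edge into degree at most m is itself the cut, and no path from there returns above m. Any
    -- other edge is continued by induction.
    by_cases hm : Φ.deg h ≤ m
    · rw [if_pos hm, Finset.sum_eq_zero, mul_zero, add_zero]
      intro p hp
      have : m < Φ.deg p.1 := by simpa [U] using (Finset.mem_product.1 hp).1
      rw [Φ.quot_eq_zero (hm.trans_lt this), zero_mul, zero_mul]
    · rw [if_neg hm, zero_add, ← ih h H (by omega)]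

theorem coef_mem (S : Subalgebra ℂ (MvPolynomial (Fin n) ℂ)) (hS : ∀ g, Φ.poly g ∈ S) (g h : G) :
    Φ.coef g h ∈ S := by
  by_cases H : Φ.coef g h = 0
  · rw [H]; exact S.zero_mem
  obtain ⟨c, ⟨h1, h2⟩ | ⟨x, h1, h2⟩⟩ := Φ.coef_eq g h H
  · rw [h2]; exact S.algebraMap_mem c
  · rw [h2]; exact S.mul_mem (S.algebraMap_mem c) (hS x)

theorem quot_mem (S : Subalgebra ℂ (MvPolynomial (Fin n) ℂ)) (hS : ∀ g, Φ.poly g ∈ S) (u v : G) :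
    Φ.quot u v ∈ S := by
  induction u using Φ.rank_induction with
  | h u ih =>
    rw [quot_eq]
    refine S.add_mem ?_ (S.sum_mem fun w _ => ?_)
    · split_ifs
      exacts [S.one_mem, S.zero_mem]
    · by_cases H : Φ.coef u w = 0
      · rw [H, zero_mul]; exact S.zero_mem
      · exact S.mul_mem (Φ.coef_mem S hS u w) (ih w H)

end DegreeSystem

/-! ### Counting cuts -/

/-- A bound for the number of cuts needed to break a polynomial of a degree system of degree `e`
into factors of degree at most `D`. -/
def polyCuts (D e : ℕ) : ℕ := if e ≤ D then 0 else 4 * e / D - 2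

/-- A bound for the number of cuts needed to break a path sum of degree `e`
into factors of degree at most `D`. -/
def quotCuts (D e : ℕ) : ℕ := if e ≤ D then 0 else 4 * e / D - 1

section Cuts

variable {D e : ℕ}

theorem cuts_add_le (D x y z : ℕ) : 4 * x / D + 4 * y / D + 4 * z / D ≤ 4 * (x + y + z) / D :=
  calc _ ≤ (4 * x + 4 * y) / D + 4 * z / D :=
        Nat.add_le_add_right (Nat.div_add_div_le_add_div) _
    _ ≤ (4 * x + 4 * y + 4 * z) / D := Nat.div_add_div_le_add_div
    _ = _ := by ring_nf

theorem four_le_cuts (hD : 1 ≤ D) {x : ℕ} (hx : ¬ x ≤ D) : 4 ≤ 4 * x / D := by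
  rw [Nat.le_div_iff_mul_le hD]; omega

theorem cuts_half_add_two_le (hD : 1 ≤ D) {x : ℕ} (he : ¬ e ≤ D) (hx : 2 * x ≤ e) :
    4 * x / D + 2 ≤ 4 * e / D :=
  calc _ = (4 * x + 2 * D) / D := (Nat.add_mul_div_right _ _ hD).symm
    _ ≤ _ := Nat.div_le_div_right (by omega)

/-- The quotients 4x/D are superadditive, which pays when several parts exceed D. If only one does,
halving the degree saves 2, which covers the cut together with the smaller offset of a path sum. -/
theorem polyCuts_step (hD : 1 ≤ D) {x y z : ℕ} (he : ¬ e ≤ D) (hx : 2 * x ≤ e) (hy : 2 * y ≤ e)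
    (hz : 2 * z ≤ e) (hs : x + y + z = e) :
    1 + quotCuts D x + polyCuts D y + polyCuts D z ≤ polyCuts D e := by
  have h1 := cuts_add_le D x y z
  have h2 := cuts_half_add_two_le hD he hx
  have h3 := cuts_half_add_two_le hD he hy
  have h4 := cuts_half_add_two_le hD he hz
  have h5 := four_le_cuts hD he
  have h6 := fun h => four_le_cuts hD (x := x) h
  have h7 := fun h => four_le_cuts hD (x := y) h
  have h8 := fun h => four_le_cuts hD (x := z) h
  rw [hs] at h1
  unfold polyCuts quotCuts
  generalize 4 * x / D = p at *
  generalize 4 * y / D = q at *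
  generalize 4 * z / D = r at *
  generalize 4 * e / D = t at *
  split_ifs <;> omega

/-- The middle part y is not bounded by e/2 and may equal e. The offset of `polyCuts`, larger by
one, pays for the cut in that case. -/
theorem quotCuts_step (hD : 1 ≤ D) {x y z : ℕ} (he : ¬ e ≤ D) (hx : 2 * x ≤ e)
    (hz : 2 * z ≤ e) (hs : x + y + z = e) :
    1 + quotCuts D x + polyCuts D y + quotCuts D z ≤ quotCuts D e := by
  have h1 := cuts_add_le D x y z
  have h2 := cuts_half_add_two_le hD he hx
  have h4 := cuts_half_add_two_le hD he hz
  have h5 := four_le_cuts hD he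
  have h6 := fun h => four_le_cuts hD (x := x) h
  have h7 := fun h => four_le_cuts hD (x := y) h
  have h8 := fun h => four_le_cuts hD (x := z) h
  rw [hs] at h1
  unfold polyCuts quotCuts
  generalize 4 * x / D = p at *
  generalize 4 * y / D = q at *
  generalize 4 * z / D = r at *
  generalize 4 * e / D = t at *
  split_ifs <;> omega

end Cuts

/-- Three factors contribute 2³ = 8 to the fan-in; the sum contributes N, and 8N ≤ 2B restores the
leading 2. In the formal degree a cut costs 3M: two further leaves, and one M to absorb the scalar
attached to the coefficient. -/
theorem BorderApprox.sum_mul_mul {n N B M : ℕ} (hB : 4 * N ≤ B) (hM : 1 ≤ M) {ι : Type*}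
    {s : Finset ι} (hs : s.card ≤ N) {a e : ℕ} {F : ι → MvPolynomial (Fin n) ℂ}
    (h : ∀ i ∈ s, F i ≠ 0 → ∃ a₁ a₂ a₃ e₁ e₂ e₃ f₁ f₂ f₃, F i = f₁ * f₂ * f₃ ∧
      1 + a₁ + a₂ + a₃ ≤ a ∧ e₁ + e₂ + e₃ = e ∧
      f₁.IsHomogeneous e₁ ∧ f₂.IsHomogeneous e₂ ∧ f₃.IsHomogeneous e₃ ∧
      BorderApprox (2 * B ^ a₁) ((1 + 3 * a₁) * M) e₁ f₁ ∧
      BorderApprox (2 * B ^ a₂) (1 + (1 + 3 * a₂) * M) e₂ f₂ ∧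
      BorderApprox (2 * B ^ a₃) ((1 + 3 * a₃) * M) e₃ f₃) :
    BorderApprox (2 * B ^ a) ((1 + 3 * a) * M) e (∑ i ∈ s, F i) := by
  rcases s.eq_empty_or_nonempty with rfl | hne
  · simpa using zero _ _ _
  have hB1 : 1 ≤ B := by have := hne.card_pos; omega
  by_cases hall : ∀ i ∈ s, F i = 0
  · rw [Finset.sum_eq_zero hall]; exact zero _ _ _
  have ha : 1 ≤ a := by
    push Not at hall
    obtain ⟨i, hi, h0⟩ := hall
    obtain ⟨a₁, a₂, a₃, e₁, e₂, e₃, f₁, f₂, f₃, -, ha, -⟩ := h i hi h0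
    omega
  refine (BorderApprox.sum (N := 8 * B ^ (a - 1)) (M := (1 + 3 * a) * M) s F
    fun i hi => ?_).mono ?_ le_rfl
  · by_cases h0 : F i = 0
    · rw [h0]; exact zero _ _ _
    obtain ⟨a₁, a₂, a₃, e₁, e₂, e₃, f₁, f₂, f₃, hF, ha, rfl, h1, h2, h3, k1, k2, k3⟩ := h i hi h0
    rw [hF]
    refine ((k1.mul k2 h1 h2).mul k3 (h1.mul h2) h3).mono ?_ ?_
    · calc _ = 8 * B ^ (a₁ + a₂ + a₃) := by ring
        _ ≤ _ := Nat.mul_le_mul_left _ (Nat.pow_le_pow_right hB1 (by omega))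
    · calc _ = 1 + (3 + 3 * (a₁ + a₂ + a₃)) * M := by ring
        _ ≤ M + (3 + 3 * (a₁ + a₂ + a₃)) * M := by omega
        _ = (1 + 3 * (1 + a₁ + a₂ + a₃)) * M := by ring
        _ ≤ _ := Nat.mul_le_mul_right _ (by omega)
  · calc s.card * (8 * B ^ (a - 1)) ≤ N * (8 * B ^ (a - 1)) := Nat.mul_le_mul_right _ hs
      _ = 2 * ((4 * N) * B ^ (a - 1)) := by ring
      _ ≤ 2 * (B * B ^ (a - 1)) := by gcongr
      _ = _ := by rw [← pow_succ', Nat.sub_add_cancel ha]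

/-! ### Recursive halving of the degree -/

namespace DegreeSystem

variable {n : ℕ} {G : Type} [Fintype G] (Φ : DegreeSystem n G)

theorem coef_borderApprox {B M D e : ℕ} (hB : 1 ≤ B) {w w' : G}
    (hw : Φ.coef w w' ≠ 0) (he : Φ.deg w - Φ.deg w' = e)
    (hP : ∀ x, Φ.deg x = e →
      BorderApprox (2 * B ^ polyCuts D e) ((1 + 3 * polyCuts D e) * M) e (Φ.poly x)) :
    BorderApprox (2 * B ^ polyCuts D e) (1 + (1 + 3 * polyCuts D e) * M) e (Φ.coef w w') := by
  obtain ⟨c, ⟨h1, h2⟩ | ⟨x, h1, h2⟩⟩ := Φ.coef_eq w w' hw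
  · rw [h2]
    exact (BorderApprox.const c e).mono
      (by have := Nat.one_le_pow (polyCuts D e) B hB; omega) (by omega)
  · rw [h2]
    simpa using (BorderApprox.const c 0).mul (hP x (by omega)) (isHomogeneous_C _ _)
      ((by omega : Φ.deg x = e) ▸ Φ.isHomogeneous x)

/-- Strong induction on e. The subalgebra `S` ensures that the path sums, too, meet the base case
with the same restricted set of variables. -/
theorem borderApprox {D B M : ℕ} (hD : 1 ≤ D) (hM : 1 ≤ M) (hB : 4 * Fintype.card G ^ 2 ≤ B)
    (S : Subalgebra ℂ (MvPolynomial (Fin n) ℂ)) (hS : ∀ g, Φ.poly g ∈ S)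
    (hbase : ∀ e ≤ D, ∀ f ∈ S, f.IsHomogeneous e → BorderApprox 2 M e f) (e : ℕ) :
    (∀ g, Φ.deg g = e →
      BorderApprox (2 * B ^ polyCuts D e) ((1 + 3 * polyCuts D e) * M) e (Φ.poly g)) ∧
    (∀ u v, Φ.deg u = Φ.deg v + e →
      BorderApprox (2 * B ^ quotCuts D e) ((1 + 3 * quotCuts D e) * M) e (Φ.quot u v)) := by
  classical
  induction e using Nat.strong_induction_on with
  | _ e ih =>
  have hcard (s : Finset (G × G)) : s.card ≤ Fintype.card G ^ 2 := by
    rw [sq, ← Fintype.card_prod]; exact Finset.card_le_univ s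
  have hB1 (g : G) : 1 ≤ B := by
    have := Nat.one_le_pow 2 _ (Fintype.card_pos_iff.2 ⟨g⟩)
    omega
  by_cases he : e ≤ D
  · simp only [polyCuts, quotCuts, if_pos he, pow_zero, mul_one, mul_zero, add_zero, one_mul]
    refine ⟨fun g hg => hbase e he _ (hS g) (hg ▸ Φ.isHomogeneous g), fun u v huv => ?_⟩
    have := Φ.quot_isHomogeneous u v
    rw [huv, Nat.add_sub_cancel_left] at this
    exact hbase e he _ (Φ.quot_mem S hS u v) this
  have hP (g : G) (hg : Φ.deg g = e) :
      BorderApprox (2 * B ^ polyCuts D e) ((1 + 3 * polyCuts D e) * M) e (Φ.poly g) := by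
    -- Since e > D ≥ 1, every vertex above e/2 has degree at least 2, where the linear equation is
    -- available.
    rw [Φ.eq_sum_cut Φ.poly (e / 2) (fun u hu => Φ.poly_eq u (by omega)) g (by omega)]
    refine BorderApprox.sum_mul_mul hB hM (hcard _) fun p hp hne => ?_
    obtain ⟨w, w'⟩ := p
    simp only [Finset.mem_filter, Finset.mem_univ, true_and] at hp hne
    have hc : Φ.coef w w' ≠ 0 := fun H => hne (by rw [H]; ring)
    have hw : Φ.deg w ≤ Φ.deg g := by
      by_contra H
      exact hne (by rw [Φ.quot_eq_zero (not_le.1 H)]; ring)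
    have d1 := Φ.deg_le hc
    have d2 := Φ.deg_le_two_mul _ _ hc
    exact ⟨_, _, _, Φ.deg g - Φ.deg w, Φ.deg w - Φ.deg w', Φ.deg w', _, _, _, rfl,
      polyCuts_step hD he (by omega) (by omega) (by omega) (by omega), by omega,
      Φ.quot_isHomogeneous _ _, Φ.coef_isHomogeneous _ _, Φ.isHomogeneous _,
      (ih _ (by omega)).2 _ _ (by dsimp only; omega),
      Φ.coef_borderApprox (hB1 g) hc rfl (ih _ (by omega)).1, (ih _ (by omega)).1 _ rfl⟩
  refine ⟨hP, fun u v huv => ?_⟩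
  -- Cutting halfway between the degrees of v and u: above the threshold no vertex is v, so the
  -- trivial path drops out of the recursion.
  rw [Φ.eq_sum_cut (fun u => Φ.quot u v) (Φ.deg v + e / 2) (fun u hu => by
    rw [quot_eq, if_neg (by rintro rfl; omega), zero_add]) u (by omega)]
  refine BorderApprox.sum_mul_mul hB hM (hcard _) fun p hp hne => ?_
  obtain ⟨w, w'⟩ := p
  simp only [Finset.mem_filter, Finset.mem_univ, true_and] at hp hne
  have hc : Φ.coef w w' ≠ 0 := fun H => hne (by rw [H]; ring)
  have hw : Φ.deg w ≤ Φ.deg u := by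
    by_contra H
    exact hne (by rw [Φ.quot_eq_zero (not_le.1 H)]; ring)
  have hw' : Φ.deg v ≤ Φ.deg w' := by
    by_contra H
    exact hne (by rw [Φ.quot_eq_zero (not_le.1 H)]; ring)
  have d1 := Φ.deg_le hc
  exact ⟨_, _, _, Φ.deg u - Φ.deg w, Φ.deg w - Φ.deg w', Φ.deg w' - Φ.deg v, _, _, _, rfl,
    quotCuts_step hD he (by omega) (by omega) (by omega), by omega,
    Φ.quot_isHomogeneous _ _, Φ.coef_isHomogeneous _ _, Φ.quot_isHomogeneous _ _,
    (ih _ (by omega)).2 _ _ (by dsimp only; omega),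
    -- The coefficient can carry the full degree e, so the bound for components at this same e,
    -- proved first, is needed here.
    Φ.coef_borderApprox (hB1 u) hc rfl (by
      rcases (by omega : Φ.deg w - Φ.deg w' < e ∨ Φ.deg w - Φ.deg w' = e) with H | H
      · exact (ih _ H).1
      · rw [H]; exact hP),
    (ih _ (by omega)).2 _ _ (by dsimp only; omega)⟩

end DegreeSystem

/-! ### From circuits to straight-line programs -/

/-- Straight-line programs, the last instruction first: each entry is a variable, a constant,
or a sum or product of two later entries of the list. -/
inductive StraightLine : List (MvPolynomial (Fin n) ℂ) → Prop
  | nil : StraightLine []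
  | var {L} (i : Fin n) : StraightLine L → StraightLine (X i :: L)
  | const {L} (a : ℂ) : StraightLine L → StraightLine (C a :: L)
  | add {L p q} : StraightLine L → p ∈ L → q ∈ L → StraightLine ((p + q) :: L)
  | mul {L p q} : StraightLine L → p ∈ L → q ∈ L → StraightLine ((p * q) :: L)

namespace StraightLine

variable {L : List (MvPolynomial (Fin n) ℂ)}

/-- One instruction per wire and one for the empty sum; this is why the program length is bounded by
vertices plus wires. -/
theorem exists_sum (h : StraightLine L) (l : List (MvPolynomial (Fin n) ℂ)) (hl : ∀ p ∈ l, p ∈ L) :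
    ∃ L', StraightLine (L' ++ L) ∧ l.sum ∈ L' ++ L ∧ L'.length ≤ l.length + 1 := by
  induction l with
  | nil => exact ⟨[C 0], h.const 0, by simp, by simp⟩
  | cons a l ih =>
    obtain ⟨L', h1, h2, h3⟩ := ih fun p hp => hl p (List.mem_cons_of_mem _ hp)
    exact ⟨(a + l.sum) :: L', h1.add (List.mem_append_right _ (hl a List.mem_cons_self)) h2,
      by simp, by simpa using h3⟩

theorem exists_prod (h : StraightLine L) (l : List (MvPolynomial (Fin n) ℂ))
    (hl : ∀ p ∈ l, p ∈ L) :
    ∃ L', StraightLine (L' ++ L) ∧ l.prod ∈ L' ++ L ∧ L'.length ≤ l.length + 1 := by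
  induction l with
  | nil => exact ⟨[C 1], h.const 1, by simp, by simp⟩
  | cons a l ih =>
    obtain ⟨L', h1, h2, h3⟩ := ih fun p hp => hl p (List.mem_cons_of_mem _ hp)
    exact ⟨(a * l.prod) :: L', h1.mul (List.mem_append_right _ (hl a List.mem_cons_self)) h2,
      by simp, by simpa using h3⟩

theorem exists_of_circuit (Φ : ArithCircuit ℂ n) :
    ∃ L, StraightLine L ∧ Φ.eval ∈ L ∧ L.length ≤ Φ.size := by
  have key (m : ℕ) (hm : m ≤ Φ.numVertices) : ∃ L, StraightLine L ∧
      (∀ v : Fin Φ.numVertices, v.val < m → Φ.value v ∈ L) ∧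
      L.length ≤ ∑ v : Fin Φ.numVertices with v.val < m, (1 + (Φ.gate v).fanIn) := by
    induction m with
    | zero => exact ⟨[], .nil, by simp, by simp⟩
    | succ m ih =>
      obtain ⟨L, h1, h2, h3⟩ := ih (by omega)
      let v : Fin Φ.numVertices := ⟨m, hm⟩
      obtain ⟨L', k1, k2, k3⟩ : ∃ L', StraightLine (L' ++ L) ∧ Φ.value v ∈ L' ++ L ∧
          L'.length ≤ 1 + (Φ.gate v).fanIn := by
        rw [ArithCircuit.value]
        cases hg : Φ.gate v with
        | var i => exact ⟨[X i], h1.var i, by simp, by simp⟩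
        | const a => exact ⟨[C a], h1.const a, by simp, by simp⟩
        | add l =>
          obtain ⟨L', k1, k2, k3⟩ := h1.exists_sum
            (l.map fun u : Fin v.val => Φ.value ⟨u.val, u.isLt.trans v.isLt⟩) (by
              simp only [List.mem_map]
              rintro _ ⟨u, -, rfl⟩
              exact h2 _ u.isLt)
          exact ⟨L', k1, k2, by simpa [Gate.fanIn, add_comm] using k3⟩
        | mul l =>
          obtain ⟨L', k1, k2, k3⟩ := h1.exists_prod
            (l.map fun u : Fin v.val => Φ.value ⟨u.val, u.isLt.trans v.isLt⟩) (by
              simp only [List.mem_map]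
              rintro _ ⟨u, -, rfl⟩
              exact h2 _ u.isLt)
          exact ⟨L', k1, k2, by simpa [Gate.fanIn, add_comm] using k3⟩
      refine ⟨L' ++ L, k1, fun w hw => ?_, ?_⟩
      · rcases Nat.lt_succ_iff_lt_or_eq.1 hw with H | H
        · exact List.mem_append_right _ (h2 w H)
        · obtain rfl : w = v := Fin.ext H
          exact k2
      · have hset : (Finset.univ.filter fun w : Fin Φ.numVertices => w.val < m + 1) =
            insert v (Finset.univ.filter fun w : Fin Φ.numVertices => w.val < m) := by
          ext w
          simp only [Finset.mem_filter, Finset.mem_univ, true_and, Finset.mem_insert, Fin.ext_iff,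
            v]
          omega
        rw [hset, Finset.sum_insert (by simp [v]), List.length_append]
        omega
  obtain ⟨L, h1, h2, h3⟩ := key _ le_rfl
  refine ⟨L, h1, h2 _ Φ.output.isLt, h3.trans_eq ?_⟩
  simp [ArithCircuit.size, Finset.sum_add_distrib]

theorem get_eq (h : StraightLine L) (i : Fin L.length) :
    (∃ x, L.get i = X x) ∨ (∃ c, L.get i = C c) ∨
    (∃ j k, i < j ∧ i < k ∧ L.get i = L.get j + L.get k) ∨
    (∃ j k, i < j ∧ i < k ∧ L.get i = L.get j * L.get k) := by
  have tail (a : MvPolynomial (Fin n) ℂ) (L : List (MvPolynomial (Fin n) ℂ)) (i : Fin L.length)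
      (h : (∃ x, L.get i = X x) ∨ (∃ c, L.get i = C c) ∨
        (∃ j k, i < j ∧ i < k ∧ L.get i = L.get j + L.get k) ∨
        (∃ j k, i < j ∧ i < k ∧ L.get i = L.get j * L.get k)) :
      (∃ x, (a :: L).get i.succ = X x) ∨ (∃ c, (a :: L).get i.succ = C c) ∨
        (∃ j k, i.succ < j ∧ i.succ < k ∧ (a :: L).get i.succ = (a :: L).get j + (a :: L).get k) ∨
        (∃ j k, i.succ < j ∧ i.succ < k ∧
          (a :: L).get i.succ = (a :: L).get j * (a :: L).get k) := by
    rcases h with h | h | ⟨j, k, hj, hk, h⟩ | ⟨j, k, hj, hk, h⟩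
    · exact Or.inl h
    · exact Or.inr (Or.inl h)
    · exact Or.inr (Or.inr (Or.inl ⟨j.succ, k.succ, Fin.succ_lt_succ_iff.2 hj,
        Fin.succ_lt_succ_iff.2 hk, h⟩))
    · exact Or.inr (Or.inr (Or.inr ⟨j.succ, k.succ, Fin.succ_lt_succ_iff.2 hj,
        Fin.succ_lt_succ_iff.2 hk, h⟩))
  induction h with
  | nil => exact i.elim0
  | var x _ ih => exact Fin.cases (Or.inl ⟨x, rfl⟩) (fun i => tail _ _ i (ih i)) i
  | const a _ ih => exact Fin.cases (Or.inr (Or.inl ⟨a, rfl⟩)) (fun i => tail _ _ i (ih i)) i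
  | add _ hp hq ih =>
    obtain ⟨j, hj⟩ := List.mem_iff_get.1 hp
    obtain ⟨k, hk⟩ := List.mem_iff_get.1 hq
    refine Fin.cases (Or.inr (Or.inr (Or.inl ⟨j.succ, k.succ, Fin.succ_pos _, Fin.succ_pos _, ?_⟩)))
      (fun i => tail _ _ i (ih i)) i
    subst hj hk
    rfl
  | mul _ hp hq ih =>
    obtain ⟨j, hj⟩ := List.mem_iff_get.1 hp
    obtain ⟨k, hk⟩ := List.mem_iff_get.1 hq
    refine Fin.cases (Or.inr (Or.inr (Or.inr ⟨j.succ, k.succ, Fin.succ_pos _, Fin.succ_pos _, ?_⟩)))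
      (fun i => tail _ _ i (ih i)) i
    subst hj hk
    rfl

/-- A program of length ℓ mentions at most ℓ variables, so the final bounds depend on s and not on
n. -/
theorem exists_supported (h : StraightLine L) :
    ∃ σ : Finset (Fin n), σ.card ≤ L.length ∧
      ∀ p ∈ L, p ∈ supported ℂ (σ : Set (Fin n)) := by
  classical
  induction h with
  | nil => exact ⟨∅, by simp, by simp⟩
  | var x _ ih =>
    obtain ⟨σ, h1, h2⟩ := ih
    refine ⟨insert x σ, (Finset.card_insert_le _ _).trans (by simpa using h1), ?_⟩
    simp only [List.mem_cons, forall_eq_or_imp]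
    exact ⟨X_mem_supported.2 (by simp),
      fun p hp => supported_mono (Finset.coe_subset.2 (Finset.subset_insert _ _)) (h2 p hp)⟩
  | const a _ ih =>
    obtain ⟨σ, h1, h2⟩ := ih
    refine ⟨σ, h1.trans (by simp), ?_⟩
    simp only [List.mem_cons, forall_eq_or_imp]
    exact ⟨Subalgebra.algebraMap_mem _ a, h2⟩
  | add _ hp hq ih =>
    obtain ⟨σ, h1, h2⟩ := ih
    refine ⟨σ, h1.trans (by simp), ?_⟩
    simp only [List.mem_cons, forall_eq_or_imp]
    exact ⟨add_mem (h2 _ hp) (h2 _ hq), h2⟩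
  | mul _ hp hq ih =>
    obtain ⟨σ, h1, h2⟩ := ih
    refine ⟨σ, h1.trans (by simp), ?_⟩
    simp only [List.mem_cons, forall_eq_or_imp]
    exact ⟨mul_mem (h2 _ hp) (h2 _ hq), h2⟩

end StraightLine

/-! ### Homogeneous components form a degree system -/

theorem homogeneousComponent_mem_supported {σ : Set (Fin n)} {f : MvPolynomial (Fin n) ℂ}
    (hf : f ∈ supported ℂ σ) (e : ℕ) : homogeneousComponent e f ∈ supported ℂ σ := by
  rw [mem_supported] at *
  intro i hi
  obtain ⟨m, hm, him⟩ := (mem_vars_iff_mem_support i).1 hi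
  rw [support_homogeneousComponent, Finset.mem_filter] at hm
  exact hf ((mem_vars_iff_mem_support i).2 ⟨m, hm.1, him⟩)

theorem homogeneousComponent_mul (f g : MvPolynomial (Fin n) ℂ) (e : ℕ) :
    homogeneousComponent e (f * g) =
      ∑ a ∈ Finset.range (e + 1), homogeneousComponent a f * homogeneousComponent (e - a) g := by
  classical
  ext m
  rw [coeff_homogeneousComponent, coeff_sum]
  simp only [coeff_mul, coeff_homogeneousComponent]
  rw [Finset.sum_comm]
  have h (p : (Fin n →₀ ℕ) × (Fin n →₀ ℕ)) (hp : p ∈ Finset.HasAntidiagonal.antidiagonal m) :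
      ∑ a ∈ Finset.range (e + 1), (if p.1.degree = a then coeff p.1 f else 0) *
        (if p.2.degree = e - a then coeff p.2 g else 0) =
      if m.degree = e then coeff p.1 f * coeff p.2 g else 0 := by
    have hm : m.degree = p.1.degree + p.2.degree := by
      rw [← Finset.HasAntidiagonal.mem_antidiagonal.1 hp, map_add]
    simp only [ite_mul, zero_mul]
    rw [Finset.sum_ite_eq]
    simp only [Finset.mem_range]
    split_ifs <;> first | rfl | omega | simp
  rw [Finset.sum_congr rfl h]
  split_ifs <;> simp

/-- The coefficients of the equation for one component of one instruction. -/
theorem exists_degreeSystem_row {N d : ℕ} (f : Fin N → MvPolynomial (Fin n) ℂ)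
    (i : Fin N) (e : Fin (d + 1))
    (hf : (∃ x, f i = X x) ∨ (∃ c, f i = C c) ∨
      (∃ j k, i < j ∧ i < k ∧ f i = f j + f k) ∨ (∃ j k, i < j ∧ i < k ∧ f i = f j * f k)) :
    ∃ a : Fin N × Fin (d + 1) → MvPolynomial (Fin n) ℂ,
      (2 ≤ e.val → homogeneousComponent e.val (f i) =
        ∑ h, a h * homogeneousComponent h.2.val (f h.1)) ∧
      ∀ h, a h ≠ 0 → i < h.1 ∧ e.val ≤ 2 * h.2.val ∧
        ∃ c, (h.2.val = e.val ∧ a h = C c) ∨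
          ∃ x : Fin N × Fin (d + 1), x.2.val + h.2.val = e.val ∧
            a h = C c * homogeneousComponent x.2.val (f x.1) := by
  classical
  rcases hf with ⟨x, hx⟩ | ⟨c, hc⟩ | ⟨j, k, hj, hk, hi⟩ | ⟨j, k, hj, hk, hi⟩
  · refine ⟨0, fun he => ?_, by simp⟩
    rw [hx, homogeneousComponent_of_mem (isHomogeneous_X ℂ x), if_neg (by omega)]
    simp
  · refine ⟨0, fun he => ?_, by simp⟩
    rw [hc, homogeneousComponent_of_mem (isHomogeneous_C (Fin n) c), if_neg (by omega)]
    simp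
  · refine ⟨fun h => C ((if h = (j, e) then 1 else 0) + (if h = (k, e) then 1 else 0)),
      fun _ => ?_, fun h hh => ?_⟩
    · simp [hi, add_mul, Finset.sum_add_distrib, apply_ite C]
    · have : h = (j, e) ∨ h = (k, e) := by
        by_contra! H
        exact hh (by simp [H.1, H.2])
      rcases this with rfl | rfl
      · exact ⟨hj, by dsimp only; omega, _, Or.inl ⟨rfl, rfl⟩⟩
      · exact ⟨hk, by dsimp only; omega, _, Or.inl ⟨rfl, rfl⟩⟩
  -- The factor of larger degree a becomes the unknown: `u` collects the terms where it comes from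
  -- j, `w` those where it comes from k. The strict inequality in `w` assigns ties to j, so each
  -- term is counted once, also when j = k.
  · let u (a : ℕ) : MvPolynomial (Fin n) ℂ := if a ≤ e.val ∧ e.val ≤ 2 * a then
      homogeneousComponent (e.val - a) (f k) * homogeneousComponent a (f j) else 0
    let w (a : ℕ) : MvPolynomial (Fin n) ℂ := if a ≤ e.val ∧ e.val < 2 * a then
      homogeneousComponent (e.val - a) (f j) * homogeneousComponent a (f k) else 0
    let A (h : Fin N × Fin (d + 1)) : MvPolynomial (Fin n) ℂ := if h.2.val ≤ e.val then
      C ((if h.1 = j ∧ e.val ≤ 2 * h.2.val then 1 else 0) +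
        (if h.1 = k ∧ e.val < 2 * h.2.val then 1 else 0)) *
          homogeneousComponent (e.val - h.2.val) (f (if h.1 = j then k else j)) else 0
    have hA (h : Fin N × Fin (d + 1)) : A h * homogeneousComponent h.2.val (f h.1) =
        (if h.1 = j then u h.2.val else 0) + (if h.1 = k then w h.2.val else 0) := by
      obtain ⟨h, a⟩ := h
      by_cases h1 : a ≤ e
      · by_cases hj' : h = j
        · subst hj'
          by_cases hk' : h = k
          · subst hk'
            by_cases h2 : e.val ≤ 2 * a.val <;> by_cases h3 : e.val < 2 * a.val <;>
              simp [A, u, w, h1, h2, h3, add_mul]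
          · by_cases h2 : e.val ≤ 2 * a.val <;> simp [A, u, h1, h2, hk']
        · by_cases hk' : h = k
          · subst hk'
            by_cases h3 : e.val < 2 * a.val <;> simp [A, w, h1, h3, hj']
          · simp [A, hj', hk']
      · simp [A, u, w, h1]
    refine ⟨A, fun _ => ?_, fun h hh => ?_⟩
    · have range_eq (F : ℕ → MvPolynomial (Fin n) ℂ) (hF : ∀ a, ¬ a ≤ e.val → F a = 0) :
          ∑ a : Fin (d + 1), F a.val = ∑ a ∈ Finset.range (e.val + 1), F a := by
        rw [Fin.sum_univ_eq_sum_range]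
        refine (Finset.sum_subset (Finset.range_subset_range.2 (by omega)) fun a _ ha => ?_).symm
        exact hF a (by simpa using ha)
      simp only [hA, Finset.sum_add_distrib, Fintype.sum_prod_type_right, Finset.sum_ite_eq',
        Finset.mem_univ, if_true]
      rw [range_eq u fun a ha => if_neg fun H => ha H.1,
        range_eq w fun a ha => if_neg fun H => ha H.1, ← Finset.sum_flip w,
        ← Finset.sum_add_distrib, hi, homogeneousComponent_mul]
      refine Finset.sum_congr rfl fun a ha => ?_
      have ha : a ≤ e.val := by simpa [Nat.lt_succ_iff] using ha
      by_cases h2 : e.val ≤ 2 * a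
      · simp only [u, w]
        rw [if_pos ⟨ha, h2⟩, if_neg (by omega), add_zero, mul_comm]
      · simp only [u, w]
        rw [if_neg (by omega), if_pos (by omega), zero_add, Nat.sub_sub_self ha]
    · have h1 : h.2.val ≤ e.val := by
        by_contra H
        exact hh (if_neg H)
      simp only [A, if_pos h1] at hh ⊢
      have h2 : (h.1 = j ∧ e.val ≤ 2 * h.2.val) ∨ (h.1 = k ∧ e.val < 2 * h.2.val) := by
        by_contra! H
        refine hh ?_
        rw [if_neg (by rintro ⟨p, q⟩; exact absurd (H.1 p) (by omega)),
          if_neg (by rintro ⟨p, q⟩; exact absurd (H.2 p) (by omega))]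
        simp
      refine ⟨?_, by omega, _, Or.inr ⟨(if h.1 = j then k else j, ⟨e.val - h.2.val, by omega⟩),
        by dsimp only; omega, rfl⟩⟩
      rcases h2 with ⟨h2, -⟩ | ⟨h2, -⟩ <;> rw [h2] <;> assumption

/-- The homogeneous components of a straight-line program form a degree system. -/
theorem StraightLine.exists_degreeSystem {L : List (MvPolynomial (Fin n) ℂ)}
    (hL : StraightLine L) (d : ℕ) :
    ∃ Φ : DegreeSystem n (Fin L.length × Fin (d + 1)),
      (∀ g, Φ.deg g = g.2.val) ∧ ∀ g, Φ.poly g = homogeneousComponent g.2.val (L.get g.1) := by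
  choose A h1 h2 using fun g : Fin L.length × Fin (d + 1) =>
    exists_degreeSystem_row L.get g.1 g.2 (hL.get_eq g.1)
  -- Instructions refer to later entries of the list, so the distance to its end is a rank that
  -- falls along edges.
  exact ⟨{ deg := fun g => g.2.val
           rank := fun g => L.length - g.1.val
           poly := fun g => homogeneousComponent g.2.val (L.get g.1)
           coef := A
           isHomogeneous := fun g => homogeneousComponent_isHomogeneous _ _
           poly_eq := h1
           rank_lt := fun g h H => by
             have := (h2 g h H).1
             have := h.1.isLt
             omega
           deg_le_two_mul := fun g h H => (h2 g h H).2.1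
           coef_eq := fun g h H => (h2 g h H).2.2 }, fun _ => rfl, fun _ => rfl⟩

/-! ### Choice of parameters and conclusion -/

theorem borderApprox_of_computableInSize {d s D : ℕ} {P : MvPolynomial (Fin n) ℂ}
    (hP : P.IsHomogeneous d) (hs : ComputableInSize P s) (hD : 1 ≤ D) :
    BorderApprox (2 * (4 * (s * (d + 1)) ^ 2) ^ polyCuts D d)
      ((1 + 3 * polyCuts D d) * (1 + (2 * s) ^ D * D)) d P := by
  obtain ⟨Γ, rfl, hΓ⟩ := hs
  obtain ⟨L, hL, hmem, hlen⟩ := StraightLine.exists_of_circuit Γ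
  obtain ⟨σ, hσ, hsupp⟩ := hL.exists_supported
  obtain ⟨Φ, hdeg, hpoly⟩ := hL.exists_degreeSystem d
  obtain ⟨i, hi⟩ := List.mem_iff_get.1 hmem
  have h := (Φ.borderApprox (B := 4 * (s * (d + 1)) ^ 2) (M := 1 + (2 * s) ^ D * D) hD
    (by omega) ?_ (supported ℂ (σ : Set (Fin n))) ?_ ?_ d).1 (i, Fin.last d) (by simp [hdeg])
  · rw [hpoly, hi] at h
    simpa [homogeneousComponent_eq_self hP] using h
  · simp only [Fintype.card_prod, Fintype.card_fin]
    gcongr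
    omega
  · intro g
    rw [hpoly]
    exact homogeneousComponent_mem_supported (hsupp _ (List.get_mem _ _)) _
  · intro e he f hf hfe
    refine (BorderApprox.of_isHomogeneous hfe hf).mono le_rfl ?_
    rcases Nat.eq_zero_or_pos e with rfl | hpos
    · simp
    have hs1 : 1 ≤ s := by have := i.isLt; omega
    have h1 : (2 * σ.card) ^ e ≤ (2 * s) ^ D :=
      (Nat.pow_le_pow_left (by omega) e).trans (Nat.pow_le_pow_right (by omega) he)
    gcongr

theorem two_mul_pow_polyCuts_le {k d s t D : ℕ} (hs : 2 ≤ s) (hd : d ≤ s ^ k) (ht : 1 ≤ t)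
    (hdD : d ≤ t * D) :
    2 * (4 * (s * (d + 1)) ^ 2) ^ polyCuts D d ≤ s ^ ((8 * k + 25) * t) ∧
      polyCuts D d ≤ 4 * t := by
  have ha : polyCuts D d ≤ 4 * t := by
    have : 4 * d / D ≤ 4 * t := Nat.div_le_of_le_mul (by nlinarith)
    unfold polyCuts
    split_ifs <;> omega
  refine ⟨?_, ha⟩
  have h1 : d + 1 ≤ s ^ (k + 1) := by
    have := Nat.one_le_pow k s (by omega)
    rw [pow_succ]
    nlinarith
  calc 2 * (4 * (s * (d + 1)) ^ 2) ^ polyCuts D d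
      ≤ s * (s ^ 2 * (s * s ^ (k + 1)) ^ 2) ^ (4 * t) := by
        refine Nat.mul_le_mul hs ((Nat.pow_le_pow_left ?_ _).trans
          (Nat.pow_le_pow_right (by positivity) ha))
        have : 4 ≤ s ^ 2 := by nlinarith
        gcongr
    _ = s ^ (1 + (2 * k + 6) * (4 * t)) := by ring
    _ ≤ _ := Nat.pow_le_pow_right (by omega) (by nlinarith)

theorem formalDegree_bound {k s t a D : ℕ} (hs : 2 ≤ s) (ht : t ≤ s ^ k) (ht1 : 1 ≤ t)
    (ha : a ≤ 4 * t) :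
    (1 + 3 * a) * (1 + (2 * s) ^ D * D) ≤ s ^ (k + 5 + 3 * D) := by
  have h1 : 1 + 3 * a ≤ s ^ 4 * s ^ k :=
    calc 1 + 3 * a ≤ 2 ^ 4 * t := by omega
      _ ≤ _ := Nat.mul_le_mul (Nat.pow_le_pow_left hs 4) ht
  have h2 : (2 * s) ^ D * D ≤ (s * s) ^ D * s ^ D := by
    refine Nat.mul_le_mul (Nat.pow_le_pow_left (Nat.mul_le_mul_right _ hs) D) ?_
    exact Nat.lt_two_pow_self.le.trans (Nat.pow_le_pow_left hs D)
  have h3 : 1 ≤ (s * s) ^ D * s ^ D := Nat.mul_pos (by positivity) (by positivity)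
  calc (1 + 3 * a) * (1 + (2 * s) ^ D * D)
      ≤ (s ^ 4 * s ^ k) * (s * ((s * s) ^ D * s ^ D)) := by
        refine Nat.mul_le_mul h1 ?_
        nlinarith
    _ = _ := by ring

theorem BorderApprox.exists_circuit {N M d : ℕ} {P : MvPolynomial (Fin n) ℂ}
    (h : BorderApprox N M d P) :
    ∃ (Γ : SigmaPiSigma (RatFunc ℂ) n) (Q : MvPolynomial (Fin n) ℂ[X]),
      Γ.topFanIn ≤ N ∧ Γ.formalDegree ≤ M ∧
      Γ.eval = MvPolynomial.map (algebraMap ℂ (RatFunc ℂ)) P +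
        MvPolynomial.C RatFunc.X * MvPolynomial.map (algebraMap ℂ[X] (RatFunc ℂ)) Q ∧
      ∀ m ∈ Q.support, d < m.degree := by
  obtain ⟨Γ, Q, h1, h2, h3, h4⟩ := h
  exact ⟨Γ, Q, h1, h2, h3, (mem_pow_idealOfVars_iff _ _).1 h4⟩

end DepthThree

/-- `ℂ(ε)` is `RatFunc ℂ` with `ε = RatFunc.X`, and `ℂ[ε, x]` is `MvPolynomial (Fin n) ℂ[X]`. -/
theorem theorem1p5 (k : ℕ) :
    ∃ c : ℕ, ∀ (n d s : ℕ) (P : MvPolynomial (Fin n) ℂ),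
      P.IsHomogeneous d → DepthThree.ComputableInSize P s → d ≤ s ^ k →
      ∀ t : ℕ, 1 ≤ t → t ≤ d →
        ∃ (C : DepthThree.SigmaPiSigma (RatFunc ℂ) n) (Q : MvPolynomial (Fin n) ℂ[X]),
          C.topFanIn ≤ s ^ (c * t) ∧
          (C.formalDegree : ℝ) ≤ (s : ℝ) ^ ((c : ℝ) * ((d : ℝ) / (t : ℝ))) ∧
          C.eval = MvPolynomial.map (algebraMap ℂ (RatFunc ℂ)) P +
            MvPolynomial.C RatFunc.X * MvPolynomial.map (algebraMap ℂ[X] (RatFunc ℂ)) Q ∧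
          ∀ m ∈ Q.support, d < m.degree := by
  -- The fan-in bound gives exponent 1 + 4t(2k + 6) ≤ (8k + 25)t; the formal degree needs only k + 5
  -- + 3D with D ≤ 2d/t.
  refine ⟨8 * k + 25, fun n d s P hP hPs hd t ht htd => ?_⟩
  have hs : 1 ≤ s := by
    obtain ⟨Φ, -, hΦ⟩ := hPs
    have := Φ.output.isLt
    unfold DepthThree.ArithCircuit.size at hΦ
    omega
  -- For s = 1 all powers of s equal 1, so one product gate with one factor must do; d ≤ 1 makes P a
  -- linear form.
  rcases hs.eq_or_lt with rfl | hs
  · obtain rfl : d = 1 := by rw [one_pow] at hd; omega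
    obtain ⟨Γ, Q, h1, h2, h3, h4⟩ :=
      (DepthThree.BorderApprox.of_isHomogeneous_one (e := 1) hP).exists_circuit
    exact ⟨Γ, Q, by simpa using h1, by simpa using h2, h3, h4⟩
  -- D is d/t rounded up; t ≤ d gives D ≤ 2d/t.
  set D := (d + t - 1) / t with hDdef
  have hDt : D * t ≤ 2 * d := (Nat.div_mul_le_self _ _).trans (by omega)
  have hdD : d ≤ t * D := by
    have h1 := Nat.div_add_mod (d + t - 1) t
    have h2 := Nat.mod_lt (d + t - 1) ht
    rw [← hDdef] at h1
    omega
  have hD : 1 ≤ D := by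
    rw [hDdef, Nat.le_div_iff_mul_le ht]
    omega
  obtain ⟨Γ, Q, h1, h2, h3, h4⟩ :=
    (DepthThree.borderApprox_of_computableInSize hP hPs hD).exists_circuit
  obtain ⟨k1, k2⟩ := DepthThree.two_mul_pow_polyCuts_le hs hd ht hdD
  refine ⟨Γ, Q, h1.trans k1, ?_, h3, h4⟩
  have k3 := h2.trans (DepthThree.formalDegree_bound (D := D) hs (htd.trans hd) ht k2)
  have ht0 : (0 : ℝ) < t := by exact_mod_cast ht
  have e1 : (1 : ℝ) ≤ d / t := by
    rw [le_div_iff₀ ht0, one_mul]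
    exact_mod_cast htd
  have e2 : (D : ℝ) ≤ 2 * (d / t) := by
    rw [← mul_div_assoc, le_div_iff₀ ht0]
    exact_mod_cast hDt
  calc (Γ.formalDegree : ℝ) ≤ (s : ℝ) ^ (k + 5 + 3 * D) := by exact_mod_cast k3
    _ = (s : ℝ) ^ ((k + 5 + 3 * D : ℕ) : ℝ) := (Real.rpow_natCast _ _).symm
    _ ≤ _ := by
      refine Real.rpow_le_rpow_of_exponent_le (by exact_mod_cast hs.le) ?_
      push_cast
      nlinarith [mul_nonneg (Nat.cast_nonneg (α := ℝ) k) (sub_nonneg.2 e1)]
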